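/- Let $\mathbb{F}$ be a field of characteristic zero, $G$ an abelian group, $X$ a finite poset, and let $I(X)$ be the incidence algebra of $X$ over $\mathbb{F}$, that is, the algebra of all functions $f:X\times X\to\mathbb{F}$ with $f(x,y)=0$ whenever $x\not\le y$, with product $(fg)(x,y)=\sum_{x\le z\le y}f(x,z)g(z,y)$. Let $e_{xx}$ ($x\in X$) be its diagonal matrix units. The group $\mathrm{Aut}(X)$ of automorphisms of the poset $X$ acts on $I(X)$ by $\alpha(f)(x,y)=f(\alpha^{-1}(x),\alpha^{-1}(y))$; in particular $\alpha(e_{xx})=e_{\alpha(x)\alpha(x)}$. For $e\in I(X)$ put $\mathscr{D}(e)=\{x\in X\mid e(x,x)\neq0\}$. By a *block triangular form* of a $G$-grading on $I(X)$ we mean finite (abelian) subgroups $H_1,\dots,H_t$ of $G$ such that, for each $i$, $\mathrm{char}\,\mathbb{F}\nmid|H_i|$ and $\mathbb{F}$ contains a primitive root of unity of order $\exp H_i$, together with orthogonal idempotents $e_1,\dots,e_t\in I(X)$ with $e_1+\dots+e_t=1$, such that $e_iI(X)e_j=0$ for $i>j$ and, for each $i$, $e_iI(X)e_i$ is isomorphic,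 as a $G$-graded algebra with unit $e_i$, to the group algebra $\mathbb{F}H_i$ (with $h\in H_i$ of degree $h$). In other words, as a graded algebra, $I(X)$ is the block upper triangular matrix algebra with diagonal blocks $\mathbb{F}H_1,\dots,\mathbb{F}H_t$, whose units are $e_1,\dots,e_t$, and with graded $(\mathbb{F}H_i,\mathbb{F}H_j)$-bimodules $M_{ij}=e_iI(X)e_j$ above the diagonal. **Theorem.** Consider any $G$-grading on $I(X)$. 1. The grading has a block triangular form. 2. Given any block triangular form of the grading, with idempotents $e_1,\dots,e_t$, there is an isomorphism $\varphi$ of graded algebras from $I(X)$ onto $I(X)$ with some $G$-grading (namely the transported one) such that $\varphi(e_1),\dots,\varphi(e_t)$ are diagonal; they are then the idempotents of a block triangular form of the latter grading, with the same $H_1,\dots,H_t$. 3. For every $G$-grading on $I(X)$ that is isomorphic to the given one, and every block triangular form of it whose idempotents $e_1,\dots,e_t$ are diagonal, there exists a subset $\mathscr{A}\subset\mathrm{Aut}(X)$ such that, for each $i=1,\dots,t$, there is a positive integer $\lambda_i$ with $$\sum_{\alpha\in\mathscr{A}}\alpha(e_{xx})=\lambda_ie_i\qquad\text{for all }x\in\mathscr{D}(e_i).$$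 -/

import Mathlib

namespace IncidenceGrading

/-- A grading of an `F`-algebra `A` by a group `G` (written multiplicatively): `A` is the internal
direct sum of the subspaces `Γ g` (independent, with sum `A`), and `Γ g * Γ h ⊆ Γ (g * h)`. -/
structure IsGrading {F A G : Type*} [Field F] [Ring A] [Algebra F A] [Group G]
    (Γ : G → Submodule F A) : Prop where
  independent : iSupIndep Γ
  span : ⨆ g, Γ g = ⊤
  mul_mem : ∀ {g h : G} {a b : A}, a ∈ Γ g → b ∈ Γ h → a * b ∈ Γ (g * h)

/-- The image of a grading under an algebra automorphism `φ`. Thus `φ` is an isomorphism of graded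
algebras from `A` with the grading `Γ` onto `A` with the grading `mapGrading φ Γ`, and every graded
isomorphism from `(A, Γ)` to `A` with some grading is of this form. -/
def mapGrading {F A G : Type*} [Field F] [Ring A] [Algebra F A]
    (φ : A ≃ₐ[F] A) (Γ : G → Submodule F A) : G → Submodule F A :=
  fun g => (Γ g).map φ.toLinearMap

/-- Block triangular form of a `G`-graded algebra `A`: the `e i` are the units of the diagonal
blocks. The blocks are the Peirce components `e i * A * e j`, those below the diagonal vanish, and
the `i`-th diagonal block `e i * A * e i` is isomorphic, as a `G`-graded algebra with unit `e i`, to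
the group algebra of the finite subgroup `H i` of `G` (an element `h` of `H i` having degree `h`).
As the `e i` are then homogeneous of degree `1`, each `e i * A * e j` is a graded bimodule over the
diagonal blocks. -/
structure IsBlockTriangularForm {F A G : Type*} [Field F] [Ring A] [Algebra F A] [Group G]
    (Γ : G → Submodule F A) {t : ℕ} (H : Fin t → Subgroup G) (e : Fin t → A) : Prop where
  idempotents : CompleteOrthogonalIdempotents e
  upper : ∀ i j : Fin t, j < i → ∀ a : A, e i * a * e j = 0
  finite : ∀ i, Finite (H i)
  comm : ∀ i, ∀ g ∈ H i, ∀ h ∈ H i, g * h = h * g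
  char_not_dvd : ∀ i, ¬ ringChar F ∣ Nat.card (H i)
  primitive_root : ∀ i, ∃ ζ : F, IsPrimitiveRoot ζ (Monoid.exponent (H i))
  diagonal_block : ∀ i, ∃ ψ : MonoidAlgebra F (H i) →ₙₐ[F] A,
    Function.Injective ψ ∧ Set.range ψ = Set.range (fun a : A => e i * a * e i) ∧
      ψ 1 = e i ∧ ∀ h : H i, ψ (MonoidAlgebra.single h 1) ∈ Γ (h : G)

section Incidence

variable {F X : Type*} [Field F] [PartialOrder X]

/-- An element of the incidence algebra is diagonal. -/
def IsDiagonal (f : IncidenceAlgebra F X) : Prop := ∀ x y : X, x ≠ y → f x y = 0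

/-- `𝒟(f)`, the set of the `x` with `f(x, x) ≠ 0`. -/
def diagSupport (f : IncidenceAlgebra F X) : Set X := {x | f x x ≠ 0}

/-- The diagonal matrix unit `e_{xx}`. -/
def diagUnit (F : Type*) {X : Type*} [Field F] [PartialOrder X] [DecidableEq X] (x : X) :
    IncidenceAlgebra F X where
  toFun a b := if a = x ∧ b = x then 1 else 0
  eq_zero_of_not_le' := by
    intro a b hab
    refine if_neg ?_
    rintro ⟨rfl, rfl⟩
    exact hab le_rfl

/-- The automorphism of the incidence algebra induced by a poset automorphism `α`:
`α(f)(x, y) = f(α⁻¹ x, α⁻¹ y)`, so that `α(e_{xy}) = e_{α(x) α(y)}`. -/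
def induced (F : Type*) {X : Type*} [Field F] [PartialOrder X] [LocallyFiniteOrder X]
    [DecidableEq X] (α : X ≃o X) : IncidenceAlgebra F X ≃ₐ[F] IncidenceAlgebra F X where
  toFun f := ⟨fun a b => f (α.symm a) (α.symm b), fun a b hab =>
    f.apply_eq_zero_of_not_le (fun h => hab (α.symm.le_iff_le.mp h))⟩
  invFun f := ⟨fun a b => f (α a) (α b), fun a b hab =>
    f.apply_eq_zero_of_not_le (fun h => hab (α.le_iff_le.mp h))⟩
  left_inv f := by ext a b; simp
  right_inv f := by ext a b; simp
  map_mul' f g := by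
    ext a b
    simp only [IncidenceAlgebra.mul_apply, IncidenceAlgebra.coe_mk]
    refine Finset.sum_bij' (fun x _ => α x) (fun x _ => α.symm x) ?_ ?_ ?_ ?_ ?_
    · intro x hx
      rw [Finset.mem_Icc] at hx ⊢
      exact ⟨α.symm_apply_le.mp hx.1, α.le_symm_apply.mp hx.2⟩
    · intro x hx
      rw [Finset.mem_Icc] at hx ⊢
      exact ⟨α.symm.le_iff_le.mpr hx.1, α.symm.le_iff_le.mpr hx.2⟩
    · intro x _; simp
    · intro x _; simp
    · intro x _; simp
  map_add' f g := by ext a b; rfl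
  commutes' c := by
    ext a b
    simp [Algebra.algebraMap_eq_smul_one, IncidenceAlgebra.constSMul_apply]

theorem induced_diagUnit [LocallyFiniteOrder X] [DecidableEq X] (α : X ≃o X) (x : X) :
    induced F α (diagUnit F x) = diagUnit F (α x) := by
  ext a b
  simp [induced, diagUnit, OrderIso.symm_apply_eq]

end Incidence

end IncidenceGrading

/-! Over the algebraic closure `K` of `F`, a character `χ : G → Kˣ` twists the grading: multiplying
the degree `g` component by `χ g` embeds `I(X)` over `F` into `I(X)` over `K`. Such an embedding
sends the `e_{xx}` to orthogonal idempotents conjugate to diagonal ones, and there are only `|X|`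
diagonal places, so it permutes these places by a poset automorphism `α`, with `χ(g) a(αx, αx) =
a(x, x)` for `a` of degree `g`.

Call two points equivalent if the diagonals of degree `1` elements do not separate them. Relative to
a base point `x`, each point `y` of its class defines a character on the group of degrees visible on
the diagonal at `x`. It extends to `G` because `Kˣ` is divisible, and the resulting `α` preserves
all classes and takes `x` to `y` (`exists_orderIso_apply_eq`). Hence the class-preserving
automorphisms act transitively on each class, and classes are antichains.

The indicators of the classes lift to idempotents of degree `1`. A block cut out by such an
idempotent is determined by its diagonal on an antichain, and so is the group algebra of the visible
degrees; sorting classes by the size of lower sets makes the form triangular. Conversely, the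
support of any block unit lies in one class, since the degree `1` part of a group algebra is the
scalars. Averaging over the finite transitive group then gives the last claim. -/

namespace IncidenceGrading

/-! ### Homogeneous components and transport of gradings -/

namespace IsGrading

variable {F A G M : Type*} [Field F] [Ring A] [Algebra F A] [Group G]
  [AddCommGroup M] [Module F M] {Γ : G → Submodule F A}

/-- Linear maps on a graded algebra can be prescribed on the homogeneous components. -/
theorem exists_linearMap (hΓ : IsGrading Γ) (L : G → A →ₗ[F] M) :
    ∃ T : A →ₗ[F] M, ∀ g, ∀ a ∈ Γ g, T a = L g a := by
  classical
  have hint : DirectSum.IsInternal Γ :=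
    DirectSum.isInternal_submodule_of_iSupIndep_of_iSup_eq_top hΓ.independent hΓ.span
  let E := LinearEquiv.ofBijective (DirectSum.coeLinearMap Γ) hint
  refine ⟨(DirectSum.toModule F G M fun g => L g ∘ₗ (Γ g).subtype) ∘ₗ E.symm.toLinearMap, ?_⟩
  intro g a ha
  have : E.symm a = DirectSum.lof F G (fun g => Γ g) g ⟨a, ha⟩ := by
    rw [LinearEquiv.symm_apply_eq]
    exact (DirectSum.coeLinearMap_lof Γ g ⟨a, ha⟩).symm
  simp [this]

@[elab_as_elim]
theorem homogeneous_induction (hΓ : IsGrading Γ) {p : A → Prop} (a : A)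
    (hom : ∀ g, ∀ a ∈ Γ g, p a) (zero : p 0) (sum : ∀ a b, p a → p b → p (a + b)) : p a :=
  Submodule.iSup_induction Γ (motive := p) (by rw [hΓ.span]; trivial) hom zero sum

open Classical in
theorem exists_proj (hΓ : IsGrading Γ) (g : G) :
    ∃ T : A →ₗ[F] A, ∀ h, ∀ a ∈ Γ h, T a = if h = g then a else 0 := by
  obtain ⟨T, hT⟩ := hΓ.exists_linearMap fun h => if h = g then LinearMap.id else 0
  refine ⟨T, fun h a ha => ?_⟩
  rw [hT h a ha]
  split_ifs <;> rfl

/-- The projection onto a homogeneous component. -/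
noncomputable def proj (hΓ : IsGrading Γ) (g : G) : A →ₗ[F] A := (hΓ.exists_proj g).choose

theorem proj_of_mem (hΓ : IsGrading Γ) {g : G} {a : A} (ha : a ∈ Γ g) : hΓ.proj g a = a := by
  exact ((hΓ.exists_proj g).choose_spec g a ha).trans (if_pos rfl)

theorem proj_of_mem_ne (hΓ : IsGrading Γ) {g h : G} (hne : h ≠ g) {a : A} (ha : a ∈ Γ h) :
    hΓ.proj g a = 0 := by
  exact ((hΓ.exists_proj g).choose_spec h a ha).trans (if_neg hne)

theorem proj_mem (hΓ : IsGrading Γ) (g : G) (a : A) : hΓ.proj g a ∈ Γ g := by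
  refine hΓ.homogeneous_induction a (fun h a ha => ?_) (by simp) fun a b ha hb => ?_
  · by_cases hg : h = g
    · subst hg; rwa [hΓ.proj_of_mem ha]
    · rw [hΓ.proj_of_mem_ne hg ha]; exact zero_mem _
  · rw [map_add]; exact add_mem ha hb

theorem eq_zero_of_proj_eq_zero (hΓ : IsGrading Γ) {a : A} (h : ∀ g, hΓ.proj g a = 0) :
    a = 0 := by
  classical
  obtain ⟨s, hs⟩ : ∃ s : Finset G, a = ∑ g ∈ s, hΓ.proj g a := by
    -- Asking for all larger sets as well lets two summands share a common set.
    suffices h : ∃ s : Finset G, ∀ t, s ⊆ t → a = ∑ g ∈ t, hΓ.proj g a from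
      h.imp fun s hs => hs s subset_rfl
    clear h
    refine hΓ.homogeneous_induction a (fun h a ha => ⟨{h}, fun t ht => ?_⟩) ⟨∅, by simp⟩ ?_
    · rw [Finset.sum_eq_single h (fun g _ hg => hΓ.proj_of_mem_ne hg.symm ha)
        (fun hh => absurd (ht (by simp)) hh), hΓ.proj_of_mem ha]
    · rintro a b ⟨s, hs⟩ ⟨t, ht⟩
      refine ⟨s ∪ t, fun u hu => ?_⟩
      simp_rw [map_add, Finset.sum_add_distrib]
      rw [← hs u (Finset.union_subset_left hu), ← ht u (Finset.union_subset_right hu)]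
  simpa [h] using hs

theorem eq_zero_of_mem_of_mem (hΓ : IsGrading Γ) {g h : G} (hne : g ≠ h) {a : A} (hg : a ∈ Γ g)
    (hh : a ∈ Γ h) : a = 0 := by
  rw [← hΓ.proj_of_mem hg, hΓ.proj_of_mem_ne hne.symm hh]

theorem proj_mul_left (hΓ : IsGrading Γ) {h : G} {a : A} (ha : a ∈ Γ h) (k : G) (b : A) :
    hΓ.proj (h * k) (a * b) = a * hΓ.proj k b := by
  refine hΓ.homogeneous_induction b (fun g b hb => ?_) (by simp) fun b c hb hc => ?_
  · by_cases hg : g = k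
    · subst hg
      rw [hΓ.proj_of_mem hb, hΓ.proj_of_mem (hΓ.mul_mem ha hb)]
    · rw [hΓ.proj_of_mem_ne hg hb, mul_zero,
        hΓ.proj_of_mem_ne (by simpa using hg) (hΓ.mul_mem ha hb)]
  · rw [mul_add, map_add, map_add, mul_add, hb, hc]

/-- The degree `1` component of the unit is itself a right identity, hence equals the unit. -/
theorem one_mem (hΓ : IsGrading Γ) : (1 : A) ∈ Γ 1 := by
  have key : ∀ a : A, a = a * hΓ.proj 1 1 := fun a => by
    refine hΓ.homogeneous_induction a (fun h a ha => ?_) (by simp) fun a b ha hb => ?_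
    · have := hΓ.proj_mul_left ha 1 1
      rwa [mul_one, mul_one, hΓ.proj_of_mem ha] at this
    · rw [add_mul, ← ha, ← hb]
  have := key 1
  rw [one_mul] at this
  rw [this]
  exact hΓ.proj_mem 1 1

theorem pow_mem (hΓ : IsGrading Γ) {g : G} {a : A} (ha : a ∈ Γ g) (n : ℕ) : a ^ n ∈ Γ (g ^ n) := by
  induction n with
  | zero => simpa using hΓ.one_mem
  | succ n ih => rw [pow_succ, pow_succ]; exact hΓ.mul_mem ih ha

theorem map (hΓ : IsGrading Γ) (φ : A ≃ₐ[F] A) : IsGrading (mapGrading φ Γ) where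
  independent := by
    have := hΓ.independent.map_orderIso (Submodule.orderIsoMapComap φ.toLinearEquiv)
    exact this
  span := by
    simp only [mapGrading]
    rw [← Submodule.map_iSup, hΓ.span, Submodule.map_top, LinearMap.range_eq_top]
    exact φ.surjective
  mul_mem := by
    rintro g h _ _ ⟨a, ha, rfl⟩ ⟨b, hb, rfl⟩
    exact ⟨a * b, hΓ.mul_mem ha hb, by simp⟩

end IsGrading

theorem IsBlockTriangularForm.map {F A G : Type*} [Field F] [Ring A] [Algebra F A] [Group G]
    {Γ : G → Submodule F A} {t : ℕ} {H : Fin t → Subgroup G} {e : Fin t → A}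
    (hH : IsBlockTriangularForm Γ H e) (φ : A ≃ₐ[F] A) :
    IsBlockTriangularForm (mapGrading φ Γ) H (fun i => φ (e i)) where
  idempotents := hH.idempotents.map φ.toRingEquiv.toRingHom
  upper i j hij a := by
    have := congrArg φ (hH.upper i j hij (φ.symm a))
    simpa using this
  finite := hH.finite
  comm := hH.comm
  char_not_dvd := hH.char_not_dvd
  primitive_root := hH.primitive_root
  diagonal_block i := by
    obtain ⟨ψ, hinj, hrange, hone, hmem⟩ := hH.diagonal_block i
    refine ⟨(φ : A →ₙₐ[F] A).comp ψ, φ.injective.comp hinj, ?_, congrArg φ hone,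
      fun h => ⟨_, hmem h, rfl⟩⟩
    change Set.range (φ ∘ ψ) = _
    rw [Set.range_comp, hrange]
    ext x
    constructor
    · rintro ⟨_, ⟨a, rfl⟩, rfl⟩
      exact ⟨φ a, by simp⟩
    · rintro ⟨a, rfl⟩
      exact ⟨_, ⟨φ.symm a, rfl⟩, by simp⟩

/-- Roots exist in `K`, so `Kˣ` is divisible, hence injective as an abelian group by Baer's
criterion. -/
theorem exists_extension_to_units {K G : Type*} [Field K] [IsAlgClosed K] [CommGroup G]
    (H : Subgroup G) (η : H →* Kˣ) : ∃ χ : G →* Kˣ, ∀ h : H, χ h = η h := by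
  have hs : ∀ {n : ℕ}, n ≠ 0 → Function.Surjective fun a : Additive Kˣ => n • a := by
    intro n hn a
    obtain ⟨z, hz⟩ := IsAlgClosed.exists_pow_nat_eq (a.toMul : K) (Nat.pos_of_ne_zero hn)
    have hz0 : z ≠ 0 := by
      rintro rfl
      rw [zero_pow hn] at hz
      exact a.toMul.ne_zero hz.symm
    refine ⟨Additive.ofMul (Units.mk0 z hz0), ?_⟩
    apply Additive.toMul.injective
    ext
    simpa using hz
  let _ : DivisibleBy (Additive Kˣ) ℕ := divisibleByOfSMulRightSurj _ _ hs
  let _ : DivisibleBy (Additive Kˣ) ℤ := AddGroup.divisibleByIntOfDivisibleByNat _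
  obtain ⟨χ, hχ⟩ := (Module.Baer.of_divisible (Additive Kˣ)).extension_property_addMonoidHom
    (MonoidHom.toAdditive H.subtype) H.subtype_injective (MonoidHom.toAdditive η)
  exact ⟨MonoidHom.toAdditive.symm χ, fun h =>
    congrArg Additive.toMul (DFunLike.congr_fun hχ (Additive.ofMul h))⟩

/-! ### Diagonals, nilpotents and idempotents of the incidence algebra -/

section
variable {F X : Type*} [Field F] [PartialOrder X]

theorem finiteDimensional_incidenceAlgebra (F X : Type*) [Field F] [PartialOrder X] [Finite X] :
    FiniteDimensional F (IncidenceAlgebra F X) :=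
  FiniteDimensional.of_injective
    ({ toFun := fun f x y => f x y, map_add' := fun _ _ => rfl, map_smul' := fun _ _ => rfl } :
      IncidenceAlgebra F X →ₗ[F] X → X → F)
    fun _ _ h => DFunLike.coe_injective h

/-- The diagonal element with prescribed diagonal. -/
def diagMatrix [DecidableEq X] (v : X → F) : IncidenceAlgebra F X where
  toFun a b := if a = b then v a else 0
  eq_zero_of_not_le' := fun _ _ hab => if_neg fun h => hab h.le

theorem isDiagonal_diagMatrix [DecidableEq X] (v : X → F) :
    IsDiagonal (diagMatrix v : IncidenceAlgebra F X) := fun _ _ h => if_neg h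

theorem diagMatrix_apply [DecidableEq X] (v : X → F) (x y : X) :
    (diagMatrix v : IncidenceAlgebra F X) x y = if x = y then v x else 0 := rfl

theorem diagUnit_eq_diagMatrix [DecidableEq X] (x : X) :
    diagUnit F x = diagMatrix (Pi.single x 1) := by
  ext a b
  simp only [diagUnit, diagMatrix_apply, IncidenceAlgebra.coe_mk, Pi.single_apply]
  split_ifs <;> simp_all

variable [LocallyFiniteOrder X] [DecidableEq X]

theorem diagMatrix_mul_apply (v : X → F) (f : IncidenceAlgebra F X) (x y : X) :
    (diagMatrix v * f) x y = v x * f x y := by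
  by_cases hxy : x ≤ y
  · simp [IncidenceAlgebra.mul_apply, diagMatrix_apply, hxy]
  · simp [IncidenceAlgebra.apply_eq_zero_of_not_le hxy]

theorem mul_diagMatrix_apply (v : X → F) (f : IncidenceAlgebra F X) (x y : X) :
    (f * diagMatrix v) x y = f x y * v y := by
  by_cases hxy : x ≤ y
  · simp [IncidenceAlgebra.mul_apply, diagMatrix_apply, hxy]
  · simp [IncidenceAlgebra.apply_eq_zero_of_not_le hxy]

/-- The algebra homomorphism taking an element of the incidence algebra to its diagonal. -/
def diagHom (F X : Type*) [Field F] [PartialOrder X] [LocallyFiniteOrder X] [DecidableEq X] :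
    IncidenceAlgebra F X →ₐ[F] (X → F) where
  toFun f x := f x x
  map_one' := by ext; simp
  map_mul' f g := by ext; simp
  map_zero' := rfl
  map_add' _ _ := rfl
  commutes' c := by
    ext x
    simp [Algebra.algebraMap_eq_smul_one, IncidenceAlgebra.constSMul_apply]

theorem diagHom_apply (f : IncidenceAlgebra F X) (x : X) : diagHom F X f x = f x x := rfl

omit [DecidableEq X] in
theorem mul_apply_self (f g : IncidenceAlgebra F X) (x : X) : (f * g) x x = f x x * g x x := by
  simp

theorem pow_apply_self (f : IncidenceAlgebra F X) (n : ℕ) (x : X) :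
    (f ^ n) x x = f x x ^ n := by
  exact congrFun (map_pow (diagHom F X) f n) x

theorem isNilpotent_of_apply_self_eq_zero [Finite X] {f : IncidenceAlgebra F X}
    (hf : ∀ x, f x x = 0) : IsNilpotent f := by
  -- With zero diagonal, a nonzero entry of `f ^ k` needs a strict chain of `k + 1` points in the
  -- interval.
  have key : ∀ (k : ℕ) (x y : X), (f ^ k) x y ≠ 0 → k < (Finset.Icc x y).card := by
    intro k
    induction k with
    | zero =>
      intro x y h
      exact Finset.card_pos.mpr ⟨x, by simpa using IncidenceAlgebra.le_of_ne_zero h⟩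
    | succ k ih =>
      intro x y h
      rw [pow_succ, IncidenceAlgebra.mul_apply] at h
      obtain ⟨z, hz, hne⟩ := Finset.exists_ne_zero_of_sum_ne_zero h
      rw [Finset.mem_Icc] at hz
      have hzy : z < y := lt_of_le_of_ne hz.2 fun h => by simp [h, hf] at hne
      refine (Nat.succ_le_of_lt (ih x z (left_ne_zero_of_mul hne))).trans_lt
        (Finset.card_lt_card ?_)
      rw [Finset.ssubset_iff_of_subset (Finset.Icc_subset_Icc_right hz.2)]
      exact ⟨y, by simpa using hz.1.trans hz.2, fun h => (Finset.mem_Icc.mp h).2.not_gt hzy⟩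
  have := Fintype.ofFinite X
  refine ⟨Fintype.card X, ?_⟩
  ext x y _
  by_contra h
  exact (key _ x y h).not_ge (Finset.card_le_univ _)

theorem IsIdempotentElem.exists_apply_self_ne_zero [Finite X] {f : IncidenceAlgebra F X}
    (hf : IsIdempotentElem f) (h0 : f ≠ 0) : ∃ x, f x x ≠ 0 := by
  by_contra! h
  obtain ⟨n, hn⟩ := isNilpotent_of_apply_self_eq_zero h
  apply h0
  rw [← hf.pow_succ_eq n, pow_succ, hn, zero_mul]

theorem isUnit_of_apply_self_eq_one [Finite X] {f : IncidenceAlgebra F X}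
    (hf : ∀ x, f x x = 1) : IsUnit f := by
  have : IsNilpotent (1 - f) := isNilpotent_of_apply_self_eq_zero fun x => by simp [hf]
  simpa using this.isUnit_one_sub

/-- Complete orthogonal idempotents of an incidence algebra are simultaneously conjugate to the
diagonal elements with the same diagonals. -/
theorem exists_conj_eq_diagMatrix [Finite X] {ι : Type*} [Fintype ι]
    {e : ι → IncidenceAlgebra F X} (he : CompleteOrthogonalIdempotents e) :
    ∃ u : (IncidenceAlgebra F X)ˣ, ∀ i, ↑u * e i * ↑u⁻¹ = diagMatrix fun x => e i x x := by
  classical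
  set d : ι → IncidenceAlgebra F X := fun i => diagMatrix fun x => e i x x with hd
  have horth : ∀ i j, d i * d j = if i = j then d i else 0 := by
    intro i j
    have h : ∀ x, e i x x * e j x x = (if i = j then e i else 0) x x := fun x => by
      rw [← mul_apply_self, he.mul_eq]
    ext x y _
    rw [hd, diagMatrix_mul_apply, diagMatrix_apply]
    by_cases hxy : x = y
    · subst hxy
      rw [if_pos rfl, h]
      split_ifs <;> simp [diagMatrix_apply]
    · split_ifs <;> simp [diagMatrix_apply, hxy]
  -- `w` intertwines the two families, `w * e j = d j * e j = d j * w`, and its diagonal is `1`, so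
  -- it is the conjugating unit.
  set w := ∑ i, d i * e i with hw
  have hright : ∀ j, w * e j = d j * e j := by
    intro j
    simp [hw, Finset.sum_mul, mul_assoc, he.mul_eq]
  have hleft : ∀ j, d j * w = d j * e j := by
    intro j
    simp [hw, Finset.mul_sum, ← mul_assoc, horth]
  have hdiag : ∀ x, w x x = 1 := by
    intro x
    have h1 := congrFun (map_sum (diagHom F X) (fun i => d i * e i) Finset.univ) x
    have h2 := congrFun (map_sum (diagHom F X) e Finset.univ) x
    rw [he.complete, map_one] at h2
    rw [diagHom_apply] at h1
    rw [hw, h1]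
    simp only [Finset.sum_apply, diagHom_apply, mul_apply_self, hd, diagMatrix_apply, if_true]
      at h2 ⊢
    rw [← Pi.one_apply (M := fun _ => F) x, h2]
    refine Finset.sum_congr rfl fun i _ => ?_
    rw [← mul_apply_self, he.idem i]
  obtain ⟨u, hu⟩ := isUnit_of_apply_self_eq_one hdiag
  refine ⟨u, fun i => ?_⟩
  rw [hu, hright, ← hleft, ← hu, mul_assoc, Units.mul_inv, mul_one]

end

/-- A monotone injective self-map of a finite partial order is an order isomorphism. -/
theorem exists_orderIso_of_monotone {X : Type*} [PartialOrder X] [Finite X] {f : X → X}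
    (hinj : Function.Injective f) (hf : Monotone f) : ∃ α : X ≃o X, ∀ x, α x = f x := by
  let σ : Equiv.Perm X := Equiv.ofBijective f (Finite.injective_iff_bijective.mp hinj)
  have hσ : ∀ n : ℕ, Monotone ⇑(σ ^ n) := by
    intro n
    induction n with
    | zero => exact fun _ _ h => h
    | succ n ih => rw [pow_succ]; exact ih.comp hf
  -- A permutation of a finite set has a power of itself as inverse, and powers of a monotone map
  -- are monotone.
  obtain ⟨n, hn, hpow⟩ := isOfFinOrder_iff_pow_eq_one.mp (isOfFinOrder_of_finite σ)
  obtain ⟨m, rfl⟩ := Nat.exists_eq_succ_of_ne_zero hn.ne'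
  have hinv : ∀ x, (σ ^ m) (σ x) = x := fun x => by
    rw [← Equiv.Perm.mul_apply, ← pow_succ, hpow, Equiv.Perm.one_apply]
  refine ⟨⟨σ, fun {a b} => ⟨fun h => ?_, fun h => hf h⟩⟩, fun x => rfl⟩
  have := hσ m h
  rwa [hinv, hinv] at this

/-! ### Twisting by characters and the induced poset automorphisms -/

section
variable {F K X : Type*} [Field F] [Field K] [Algebra F K] [PartialOrder X]
  [LocallyFiniteOrder X] [DecidableEq X]

omit [LocallyFiniteOrder X] [DecidableEq X] in
theorem sum_apply {ι : Type*} (s : Finset ι) (f : ι → IncidenceAlgebra F X) (p q : X) :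
    (∑ i ∈ s, f i) p q = ∑ i ∈ s, f i p q := by
  classical
  induction s using Finset.induction_on with
  | empty => simp
  | insert a s ha ih => rw [Finset.sum_insert ha, Finset.sum_insert ha,
      IncidenceAlgebra.add_apply, ih]

theorem diagUnit_mul_apply (x : X) (f : IncidenceAlgebra F X) (p q : X) :
    (diagUnit F x * f) p q = if p = x then f p q else 0 := by
  rw [diagUnit_eq_diagMatrix, diagMatrix_mul_apply, Pi.single_apply]
  split_ifs <;> simp

theorem mul_diagUnit_apply (x : X) (f : IncidenceAlgebra F X) (p q : X) :
    (f * diagUnit F x) p q = if q = x then f p q else 0 := by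
  rw [diagUnit_eq_diagMatrix, mul_diagMatrix_apply, Pi.single_apply]
  split_ifs <;> simp

theorem diagUnit_mul_mul_diagUnit (x : X) (f : IncidenceAlgebra F X) :
    diagUnit F x * f * diagUnit F x = f x x • diagUnit F x := by
  ext p q _
  rw [mul_diagUnit_apply, diagUnit_mul_apply, IncidenceAlgebra.constSMul_apply]
  simp only [diagUnit, IncidenceAlgebra.coe_mk]
  by_cases hp : p = x <;> by_cases hq : q = x <;> simp_all

omit [LocallyFiniteOrder X] in
theorem diagUnit_ne_zero (x : X) : diagUnit F x ≠ 0 := fun h => by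
  have := congrArg (fun f : IncidenceAlgebra F X => f x x) h
  simp [diagUnit] at this

theorem completeOrthogonalIdempotents_diagUnit [Fintype X] :
    CompleteOrthogonalIdempotents (diagUnit F : X → IncidenceAlgebra F X) where
  idem x := by
    ext p q _
    rw [diagUnit_mul_apply]
    simp only [diagUnit, IncidenceAlgebra.coe_mk]
    split_ifs <;> simp_all
  ortho x y hxy := by
    ext p q _
    change (diagUnit F x * diagUnit F y) p q = 0
    rw [diagUnit_mul_apply]
    simp only [diagUnit, IncidenceAlgebra.coe_mk]
    split_ifs <;> simp_all
  complete := by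
    ext p q _
    rw [sum_apply, IncidenceAlgebra.one_apply]
    simp only [diagUnit, IncidenceAlgebra.coe_mk]
    split_ifs with hpq
    · subst hpq
      simp
    · exact Finset.sum_eq_zero fun x _ => if_neg fun h => hpq (h.1.trans h.2.symm)

/-- The off-diagonal matrix units connect the diagonal ones. -/
theorem exists_diagUnit_mul_mul_diagUnit_ne_zero (F : Type*) [Field F] {x y : X} (hxy : x ≤ y) :
    ∃ w : IncidenceAlgebra F X, diagUnit F x * w * diagUnit F y ≠ 0 := by
  classical
  refine ⟨⟨fun a b => if a = x ∧ b = y then 1 else 0, fun a b hab => if_neg ?_⟩, fun h => ?_⟩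
  · rintro ⟨rfl, rfl⟩
    exact hab hxy
  · have := congrArg (fun f : IncidenceAlgebra F X => f x y) h
    simp only [mul_diagUnit_apply, diagUnit_mul_apply] at this
    simp at this

/-- An injective homomorphism between incidence algebras of the same finite poset over two fields
permutes the diagonal entries by an automorphism of the poset. -/
theorem exists_orderIso_of_algHom [Finite X] (Φ : IncidenceAlgebra F X →ₐ[F] IncidenceAlgebra K X)
    (hΦ : Function.Injective Φ) :
    ∃ α : X ≃o X, ∀ a x, Φ a (α x) (α x) = algebraMap F K (a x x) := by
  have := Fintype.ofFinite X
  set u : X → IncidenceAlgebra K X := fun x => Φ (diagUnit F x) with hu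
  have hcoi : CompleteOrthogonalIdempotents u :=
    completeOrthogonalIdempotents_diagUnit.map (Φ : IncidenceAlgebra F X →+* IncidenceAlgebra K X)
  have hne : ∀ x, u x ≠ 0 := fun x => (map_ne_zero_iff Φ hΦ).mpr (diagUnit_ne_zero x)
  -- The supports of the `u x` are nonempty and disjoint inside `X`; counting forces each to be the
  -- single point `f x`.
  choose f hf using fun x => IsIdempotentElem.exists_apply_self_ne_zero (hcoi.idem x) (hne x)
  have hunique : ∀ x y z, u x z z ≠ 0 → u y z z ≠ 0 → x = y := by
    intro x y z hx hy
    by_contra hxy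
    have := mul_apply_self (u x) (u y) z
    rw [hcoi.ortho hxy, IncidenceAlgebra.zero_apply] at this
    exact mul_ne_zero hx hy this.symm
  have hinj : Function.Injective f := fun x y h => hunique x y (f x) (hf x) (h ▸ hf y)
  have hsupp : ∀ x z, u x z z ≠ 0 → z = f x := by
    intro x z hz
    obtain ⟨y, rfl⟩ := (Finite.injective_iff_surjective.mp hinj) z
    rw [hunique x y _ hz (hf y)]
  have hone : ∀ x, u x (f x) (f x) = 1 := fun x => by
    have := mul_apply_self (u x) (u x) (f x)
    rw [hcoi.idem x] at this
    exact (mul_eq_left₀ (hf x)).mp this.symm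
  obtain ⟨c, hc⟩ := exists_conj_eq_diagMatrix hcoi
  -- For `x ≤ y` the corner between `u x` and `u y` is nonzero. After conjugation it lives in the
  -- single entry `(f x, f y)`, which therefore must be comparable.
  have hmono : Monotone f := by
    intro x y hxy
    obtain ⟨w, hw⟩ := exists_diagUnit_mul_mul_diagUnit_ne_zero F hxy
    have hw' : u x * Φ w * u y ≠ 0 := by
      rw [← (map_ne_zero_iff Φ hΦ), map_mul, map_mul] at hw
      exact hw
    have h0 : (↑c * u x * ↑c⁻¹) * (↑c * Φ w * ↑c⁻¹) * (↑c * u y * ↑c⁻¹) ≠ 0 := by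
      intro h
      apply hw'
      have h2 := congrArg (fun a => (↑c⁻¹ : IncidenceAlgebra K X) * a * ↑c) h
      simpa [mul_assoc] using h2
    rw [hc, hc] at h0
    by_contra hle
    apply h0
    ext p q _
    rw [mul_diagMatrix_apply, diagMatrix_mul_apply, IncidenceAlgebra.zero_apply]
    by_cases hp : u x p p = 0
    · rw [hp, zero_mul, zero_mul]
    by_cases hq : u y q q = 0
    · rw [hq, mul_zero]
    rw [hsupp x p hp, hsupp y q hq, IncidenceAlgebra.apply_eq_zero_of_not_le hle, mul_zero,
      zero_mul]
  obtain ⟨α, hα⟩ := exists_orderIso_of_monotone hinj hmono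
  refine ⟨α, fun a x => ?_⟩
  have h := congrArg (fun b : IncidenceAlgebra K X => b (f x) (f x))
    (congrArg Φ (diagUnit_mul_mul_diagUnit x a))
  simp only [map_mul, map_smul, mul_apply_self, IncidenceAlgebra.constSMul_apply] at h
  have h1 := hone x
  simp only [hu] at h1
  rw [h1, one_mul, mul_one, Algebra.smul_def, mul_one] at h
  rw [hα, h]

variable {G : Type*} [CommGroup G] {Γ : G → Submodule F (IncidenceAlgebra F X)}

theorem IsGrading.exists_twist (hΓ : IsGrading Γ) (χ : G →* Kˣ) :
    ∃ Φ : IncidenceAlgebra F X →ₐ[F] IncidenceAlgebra K X, Function.Injective Φ ∧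
      ∀ g, ∀ a ∈ Γ g, ∀ x y, Φ a x y = χ g * algebraMap F K (a x y) := by
  let L : G → IncidenceAlgebra F X →ₗ[F] IncidenceAlgebra K X := fun g =>
    { toFun := fun a => ⟨fun x y => χ g * algebraMap F K (a x y), fun x y hxy => by
        rw [IncidenceAlgebra.apply_eq_zero_of_not_le hxy, map_zero, mul_zero]⟩
      map_add' := fun a b => by
        ext x y _
        simp [mul_add]
      map_smul' := fun c a => by
        ext x y _
        simp only [RingHom.id_apply, IncidenceAlgebra.constSMul_apply, IncidenceAlgebra.coe_mk,
          smul_eq_mul, map_mul]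
        rw [Algebra.smul_def]
        ring }
  obtain ⟨T, hT⟩ := hΓ.exists_linearMap L
  have hT' : ∀ g, ∀ a ∈ Γ g, ∀ x y, T a x y = χ g * algebraMap F K (a x y) := fun g a ha x y => by
    rw [hT g a ha]; rfl
  have hone : T 1 = 1 := by
    ext x y _
    rw [hT' 1 1 hΓ.one_mem]
    simp only [IncidenceAlgebra.one_apply]
    split_ifs <;> simp
  have hmul : ∀ a b, T (a * b) = T a * T b := by
    intro a b
    refine hΓ.homogeneous_induction a (fun g a ha => ?_) (by simp) fun a a' h h' => ?_
    · refine hΓ.homogeneous_induction b (fun h b hb => ?_) (by simp) fun b b' h h' => ?_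
      · ext x y _
        rw [hT' _ _ (hΓ.mul_mem ha hb), IncidenceAlgebra.mul_apply, IncidenceAlgebra.mul_apply,
          map_sum, Finset.mul_sum]
        refine Finset.sum_congr rfl fun z _ => ?_
        rw [hT' _ _ ha, hT' _ _ hb, map_mul, map_mul, Units.val_mul]
        ring
      · rw [mul_add, map_add, map_add, mul_add, h, h']
    · rw [add_mul, map_add, map_add, add_mul, h, h']
  refine ⟨AlgHom.ofLinearMap T hone hmul, ?_, fun g a ha => hT' g a ha⟩
  rw [injective_iff_map_eq_zero]
  intro a ha
  refine hΓ.eq_zero_of_proj_eq_zero fun g => ?_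
  -- Injectivity: composing the twist with an `F`-linear functional `l` on `K` returns to `I(X)`
  -- over `F`, with degree `h` scaled by `l (χ h)`. If `l (χ g) ≠ 0`, the degree `g` component of a
  -- kernel element vanishes.
  obtain ⟨l, hl⟩ := Module.Projective.exists_dual_ne_zero F (χ g).ne_zero
  let V : IncidenceAlgebra F X →ₗ[F] IncidenceAlgebra F X :=
    { toFun := fun b => ⟨fun x y => l (T b x y), fun x y hxy => by
        rw [IncidenceAlgebra.apply_eq_zero_of_not_le hxy, map_zero]⟩
      map_add' := fun b c => by
        ext x y _
        simp
      map_smul' := fun c b => by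
        ext x y _
        simp only [map_smul, IncidenceAlgebra.constSMul_apply, IncidenceAlgebra.coe_mk,
          RingHom.id_apply] }
  have hV : ∀ h, ∀ b ∈ Γ h, V b = l (χ h) • b := fun h b hb => by
    ext x y _
    change l (T b x y) = l (χ h) * b x y
    rw [hT' h b hb, mul_comm, ← Algebra.smul_def, map_smul, smul_eq_mul, mul_comm]
  have hproj : ∀ b, hΓ.proj g (V b) = l (χ g) • hΓ.proj g b := fun b => by
    refine hΓ.homogeneous_induction b (fun h b hb => ?_) (by simp) fun b c hb hc => ?_
    · rw [hV h b hb, map_smul]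
      by_cases hg : h = g
      · rw [hg]
      · rw [hΓ.proj_of_mem_ne hg hb, smul_zero, smul_zero]
    · rw [map_add, map_add, map_add, smul_add, hb, hc]
  have hVa : V a = 0 := by
    have ha' : T a = 0 := ha
    ext x y _
    change l (T a x y) = 0
    rw [ha', IncidenceAlgebra.zero_apply, map_zero]
  have := hproj a
  rw [hVa, map_zero] at this
  exact (smul_eq_zero.mp this.symm).resolve_left hl

/-- A character of the grading group acts on the diagonals of the homogeneous elements through an
automorphism of the poset. -/
theorem IsGrading.exists_orderIso_of_character [Finite X] (hΓ : IsGrading Γ) (χ : G →* Kˣ) :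
    ∃ α : X ≃o X, ∀ g, ∀ a ∈ Γ g, ∀ x,
      χ g * algebraMap F K (a (α x) (α x)) = algebraMap F K (a x x) := by
  obtain ⟨Φ, hinj, hΦ⟩ := hΓ.exists_twist χ
  obtain ⟨α, hα⟩ := exists_orderIso_of_algHom Φ hinj
  exact ⟨α, fun g a ha x => by rw [← hΦ g a ha, hα]⟩

end

/-! ### Classes of diagonal places and transitivity on them -/

section
variable {F X G : Type*} [Field F] [PartialOrder X] [LocallyFiniteOrder X] [DecidableEq X]
  [CommGroup G] {Γ : G → Submodule F (IncidenceAlgebra F X)}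

/-- Points of the poset that the diagonals of the elements of degree `1` do not separate. -/
def diagSetoid (Γ : G → Submodule F (IncidenceAlgebra F X)) : Setoid X where
  r x y := ∀ a ∈ Γ 1, a x x = a y y
  iseqv := ⟨fun _ _ _ => rfl, fun h a ha => (h a ha).symm,
    fun h h' a ha => (h a ha).trans (h' a ha)⟩

omit [LocallyFiniteOrder X] [DecidableEq X] in
theorem ncard_Iic_lt [Finite X] {x y : X} (hxy : x < y) :
    (Set.Iic x).ncard < (Set.Iic y).ncard :=
  Set.ncard_lt_ncard (Set.Iic_ssubset_Iic.mpr hxy) (Set.toFinite _)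

/-- Conjugating the idempotents to diagonal form reduces the corner to its entries between the two
supports. -/
theorem peirce_eq_zero [Finite X] {ι : Type*} [Fintype ι] {e : ι → IncidenceAlgebra F X}
    (he : CompleteOrthogonalIdempotents e) {i j : ι} {a : IncidenceAlgebra F X}
    (h : ∀ p q, p ≤ q → e i p p ≠ 0 → e j q q ≠ 0 → p = q ∧ a p p = 0) :
    e i * a * e j = 0 := by
  obtain ⟨u, hu⟩ := exists_conj_eq_diagMatrix he
  have h0 : (↑u * e i * ↑u⁻¹) * (↑u * a * ↑u⁻¹) * (↑u * e j * ↑u⁻¹) = 0 := by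
    rw [hu, hu]
    ext p q hpq
    rw [mul_diagMatrix_apply, diagMatrix_mul_apply, IncidenceAlgebra.zero_apply]
    by_cases hp : e i p p = 0
    · rw [hp, zero_mul, zero_mul]
    by_cases hq : e j q q = 0
    · rw [hq, mul_zero]
    obtain ⟨rfl, hap⟩ := h p q hpq hp hq
    rw [mul_apply_self, mul_apply_self, hap, mul_zero, zero_mul, mul_zero, zero_mul]
  have h2 := congrArg (fun b => (↑u⁻¹ : IncidenceAlgebra F X) * b * ↑u) h0
  simpa [mul_assoc] using h2

namespace IsGrading

/-- The powers of `a` are nonzero, while finite dimension leaves only finitely many nonzero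
components. -/
theorem isOfFinOrder_of_apply_self_ne_zero [Finite X] (hΓ : IsGrading Γ) {g : G}
    {a : IncidenceAlgebra F X} (ha : a ∈ Γ g) {x : X} (hx : a x x ≠ 0) : IsOfFinOrder g := by
  have := finiteDimensional_incidenceAlgebra F X
  rw [← finite_powers]
  refine (WellFoundedGT.finite_ne_bot_of_iSupIndep hΓ.independent).subset ?_
  rintro _ ⟨n, rfl⟩ hbot
  have h := hΓ.pow_mem ha n
  rw [hbot, Submodule.mem_bot] at h
  have h2 := pow_apply_self a n x
  rw [h, IncidenceAlgebra.zero_apply] at h2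
  exact pow_ne_zero n hx h2.symm

/-- The degrees of the homogeneous elements that do not vanish at a given diagonal place. -/
def diagDegrees [Finite X] (hΓ : IsGrading Γ) (x : X) : Subgroup G where
  carrier := {g | ∃ a ∈ Γ g, a x x ≠ 0}
  one_mem' := ⟨1, hΓ.one_mem, by simp⟩
  mul_mem' := by
    rintro g h ⟨a, ha, hax⟩ ⟨b, hb, hbx⟩
    exact ⟨a * b, hΓ.mul_mem ha hb, by rw [mul_apply_self]; exact mul_ne_zero hax hbx⟩
  inv_mem' := by
    rintro g ⟨a, ha, hax⟩
    have hg := hΓ.isOfFinOrder_of_apply_self_ne_zero ha hax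
    refine ⟨a ^ (orderOf g - 1), ?_, by rw [pow_apply_self]; exact pow_ne_zero _ hax⟩
    have : g⁻¹ = g ^ (orderOf g - 1) := by
      rw [inv_eq_iff_mul_eq_one, ← pow_succ', Nat.sub_add_cancel hg.orderOf_pos, pow_orderOf_eq_one]
    rw [this]
    exact hΓ.pow_mem ha _

theorem finite_diagDegrees [Finite X] (hΓ : IsGrading Γ) (x : X) : Finite (hΓ.diagDegrees x) := by
  have := finiteDimensional_incidenceAlgebra F X
  refine ((WellFoundedGT.finite_ne_bot_of_iSupIndep hΓ.independent).subset ?_).to_subtype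
  rintro g ⟨a, ha, hax⟩ hbot
  rw [hbot, Submodule.mem_bot] at ha
  rw [ha] at hax
  exact hax rfl

/-- The power of `a` by the order of `g` has degree `1`, so equivalent points see the same value of
it. -/
theorem apply_self_ne_zero [Finite X] (hΓ : IsGrading Γ) {x y : X} (hxy : diagSetoid Γ x y) {g : G}
    {a : IncidenceAlgebra F X} (ha : a ∈ Γ g) (hx : a x x ≠ 0) : a y y ≠ 0 := by
  have hg := hΓ.isOfFinOrder_of_apply_self_ne_zero ha hx
  have hmem := hΓ.pow_mem ha (orderOf g)
  rw [pow_orderOf_eq_one] at hmem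
  have h := hxy _ hmem
  rw [pow_apply_self, pow_apply_self] at h
  intro hy
  rw [hy, zero_pow hg.orderOf_pos.ne'] at h
  exact pow_ne_zero _ hx h

/-- The diagonals of homogeneous elements of the same degree are proportional on each class. -/
theorem apply_self_mul_comm [Finite X] (hΓ : IsGrading Γ) {x y : X} (hxy : diagSetoid Γ x y) {g : G}
    {a b : IncidenceAlgebra F X} (ha : a ∈ Γ g) (hb : b ∈ Γ g) :
    a x x * b y y = a y y * b x x := by
  by_cases hbx : b x x = 0
  · have : b y y = 0 := by
      by_contra hby
      exact hΓ.apply_self_ne_zero ((diagSetoid Γ).symm hxy) hb hby hbx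
    rw [hbx, this, mul_zero, mul_zero]
  · obtain ⟨c, hc, hcx⟩ := (hΓ.diagDegrees x).inv_mem ⟨b, hb, hbx⟩
    have hcy := hΓ.apply_self_ne_zero hxy hc hcx
    have h1 := hxy (a * c) (by simpa using hΓ.mul_mem ha hc)
    have h2 := hxy (b * c) (by simpa using hΓ.mul_mem hb hc)
    rw [mul_apply_self, mul_apply_self] at h1 h2
    apply mul_right_cancel₀ (mul_ne_zero hcx hcy)
    linear_combination (b y y * c y y) * h1 - (a y y * c y y) * h2

/-- Homogeneous elements normalized at a given diagonal place. -/
theorem exists_normalized [Finite X] (hΓ : IsGrading Γ) (x : X) :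
    ∃ b : hΓ.diagDegrees x → IncidenceAlgebra F X,
      (∀ h : hΓ.diagDegrees x, b h ∈ Γ h) ∧ ∀ h, b h x x = 1 := by
  have : ∀ h : hΓ.diagDegrees x, ∃ b ∈ Γ (h : G), b x x = 1 := by
    rintro ⟨g, a, ha, hax⟩
    exact ⟨(a x x)⁻¹ • a, Submodule.smul_mem _ _ ha,
      by rw [IncidenceAlgebra.constSMul_apply, smul_eq_mul, inv_mul_cancel₀ hax]⟩
  choose b hb hbx using this
  exact ⟨b, hb, hbx⟩

section Normalized

variable [Finite X] (hΓ : IsGrading Γ) {x y : X} (hxy : diagSetoid Γ x y)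
  {b : hΓ.diagDegrees x → IncidenceAlgebra F X}
  (hb : ∀ h : hΓ.diagDegrees x, b h ∈ Γ h) (hbx : ∀ h, b h x x = 1)
include hΓ hxy hb hbx

theorem apply_self_eq_mul {h : hΓ.diagDegrees x} {a : IncidenceAlgebra F X} (ha : a ∈ Γ h) :
    a y y = a x x * b h y y := by
  rw [hΓ.apply_self_mul_comm hxy ha (hb h), hbx, mul_one]

theorem normalized_mul (h k : hΓ.diagDegrees x) : b (h * k) y y = b h y y * b k y y := by
  have := hΓ.apply_self_eq_mul hxy hb hbx (h := h * k) (hΓ.mul_mem (hb h) (hb k))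
  rw [mul_apply_self, mul_apply_self, hbx, hbx, one_mul, one_mul] at this
  exact this.symm

omit hb hbx in
theorem apply_self_eq_zero {g : G} (hg : g ∉ hΓ.diagDegrees x) {a : IncidenceAlgebra F X}
    (ha : a ∈ Γ g) : a y y = 0 := by
  by_contra h
  exact hg ⟨a, ha, hΓ.apply_self_ne_zero ((diagSetoid Γ).symm hxy) ha h⟩

theorem normalized_one : b 1 y y = 1 := by
  rw [← hxy _ (hb 1), hbx]

end Normalized

/-- The heart of the proof. Among the points of one class, the normalized homogeneous elements at
`x` detect a point through its character `η`; a character of `G` with the right restriction moves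
`x` to the point that has this `η`. -/
theorem exists_orderIso_apply_eq [Finite X] (hΓ : IsGrading Γ) {x y : X}
    (hxy : diagSetoid Γ x y) :
    ∃ α : X ≃o X, (∀ z, diagSetoid Γ (α z) z) ∧ α x = y := by
  obtain ⟨b, hb, hbx⟩ := hΓ.exists_normalized x
  let η : hΓ.diagDegrees x →* F :=
    { toFun := fun h => b h y y
      map_one' := hΓ.normalized_one hxy hb hbx
      map_mul' := hΓ.normalized_mul hxy hb hbx }
  let K := AlgebraicClosure F
  -- The inverse is needed because the twist gives `χ(h) b_h(αx, αx) = b_h(x, x) = 1`, whereas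
  -- `b_h(αx, αx)` should be `η h`.
  obtain ⟨χ, hχ⟩ := exists_extension_to_units (hΓ.diagDegrees x)
    ((Units.map (algebraMap F K : F →* K)).comp η.toHomUnits)⁻¹
  obtain ⟨α, hα⟩ := hΓ.exists_orderIso_of_character χ
  have hclass : ∀ z, diagSetoid Γ (α z) z := fun z a ha => by
    have := hα 1 a ha z
    rw [map_one, Units.val_one, one_mul] at this
    exact (algebraMap F K).injective this
  refine ⟨α, hclass, ?_⟩
  have hxα := (diagSetoid Γ).symm (hclass x)
  have hbα : ∀ h, b h (α x) (α x) = b h y y := fun h => by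
    have h1 := hα h (b h) (hb h) x
    rw [hχ, hbx, map_one, MonoidHom.inv_apply, Units.inv_mul_eq_one] at h1
    exact ((algebraMap F K).injective h1).symm
  have hall : ∀ a : IncidenceAlgebra F X, a (α x) (α x) = a y y := fun a => by
    refine hΓ.homogeneous_induction a (fun g a ha => ?_) (by simp) fun a b ha hb => ?_
    · by_cases hg : g ∈ hΓ.diagDegrees x
      · rw [hΓ.apply_self_eq_mul hxα hb hbx (h := ⟨g, hg⟩) ha, hbα,
          ← hΓ.apply_self_eq_mul hxy hb hbx (h := ⟨g, hg⟩) ha]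
      · rw [hΓ.apply_self_eq_zero hxα hg ha, hΓ.apply_self_eq_zero hxy hg ha]
    · rw [IncidenceAlgebra.add_apply, IncidenceAlgebra.add_apply, ha, hb]
  have := hall (diagUnit F y)
  by_contra hne
  simp [diagUnit, hne] at this

theorem ncard_Iic_eq [Finite X] (hΓ : IsGrading Γ) {x y : X} (hxy : diagSetoid Γ x y) :
    (Set.Iic x).ncard = (Set.Iic y).ncard := by
  obtain ⟨α, -, rfl⟩ := hΓ.exists_orderIso_apply_eq hxy
  rw [← α.image_Iic, Set.ncard_image_of_injective _ α.injective]

theorem eq_of_le_of_diagSetoid [Finite X] (hΓ : IsGrading Γ) {x y : X} (hxy : diagSetoid Γ x y)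
    (hle : x ≤ y) : x = y := by
  by_contra hne
  exact (ncard_Iic_lt (lt_of_le_of_ne hle hne)).ne (hΓ.ncard_Iic_eq hxy)

open Classical in
/-- Complete orthogonal idempotents of degree `1` whose diagonals are the indicators of the
classes. -/
theorem exists_idempotents [Finite X] (hΓ : IsGrading Γ)
    [Fintype (Quotient (diagSetoid Γ))] :
    ∃ e : Quotient (diagSetoid Γ) → IncidenceAlgebra F X, CompleteOrthogonalIdempotents e ∧
      (∀ q, e q ∈ Γ 1) ∧ ∀ q x, e q x x = if Quotient.mk _ x = q then 1 else 0 := by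
  have := Fintype.ofFinite X
  let B : Subalgebra F (IncidenceAlgebra F X) :=
    { carrier := Γ 1
      mul_mem' := fun ha hb => by simpa using hΓ.mul_mem ha hb
      add_mem' := fun ha hb => add_mem ha hb
      algebraMap_mem' := fun c => by
        rw [Algebra.algebraMap_eq_smul_one]
        exact Submodule.smul_mem _ _ hΓ.one_mem }
  let f : B →ₐ[F] (X → F) := (diagHom F X).comp B.val
  have hker : ∀ a ∈ RingHom.ker (f : B →+* (X → F)), IsNilpotent a := by
    intro a ha
    have hnil : IsNilpotent (a : IncidenceAlgebra F X) :=
      isNilpotent_of_apply_self_eq_zero fun x => congrFun ha x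
    exact (IsNilpotent.map_iff (f := B.val) Subtype.val_injective).mp hnil
  let v : Quotient (diagSetoid Γ) → X → F := fun q x => if Quotient.mk _ x = q then 1 else 0
  have hv : CompleteOrthogonalIdempotents v :=
    { idem := fun q => by ext x; simp [v]
      ortho := fun q r hqr => by
        ext x
        simp only [v, Pi.mul_apply, Pi.zero_apply]
        by_cases h : Quotient.mk _ x = q
        · rw [if_neg (h ▸ hqr : Quotient.mk _ x ≠ r), mul_zero]
        · rw [if_neg h, zero_mul]
      complete := by
        ext x
        simp [v] }
  have hrange : ∀ q, v q ∈ (f : B →+* (X → F)).range := by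
    intro q
    obtain ⟨x, rfl⟩ := Quotient.exists_rep q
    -- Lagrange interpolation: factors equal to `1` on the class of `x` and vanishing at one outside
    -- point `y` multiply to the class indicator. It is then lifted through the nil kernel of the
    -- diagonal map on the degree `1` subalgebra.
    have hsep : ∀ y, ∃ r ∈ f.range, (∀ z, diagSetoid Γ z x → r z = 1) ∧
        (¬ diagSetoid Γ y x → r y = 0) := by
      intro y
      by_cases hyx : diagSetoid Γ y x
      · exact ⟨1, Subalgebra.one_mem f.range, fun _ _ => rfl, fun h => absurd hyx h⟩
      · obtain ⟨a, ha, hne⟩ : ∃ a ∈ Γ 1, a y y ≠ a x x := by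
          by_contra! h
          exact hyx h
        refine ⟨(a x x - a y y)⁻¹ • (diagHom F X a - algebraMap F (X → F) (a y y)),
          Subalgebra.smul_mem f.range (Subalgebra.sub_mem f.range ⟨⟨a, ha⟩, rfl⟩
            (Subalgebra.algebraMap_mem f.range _)) _,
          fun z hz => ?_, fun _ => ?_⟩
        · simp only [Pi.smul_apply, Pi.sub_apply, diagHom_apply, Pi.algebraMap_apply,
            Algebra.algebraMap_self, RingHom.id_apply, smul_eq_mul]
          rw [hz a ha, inv_mul_cancel₀ (sub_ne_zero.mpr hne.symm)]
        · simp [diagHom_apply]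
    choose r hr hr1 hr0 using hsep
    have hprod : v (Quotient.mk _ x) = ∏ y, r y := by
      ext z
      rw [Finset.prod_apply]
      simp only [v, Quotient.eq]
      split_ifs with h
      · exact (Finset.prod_eq_one fun y _ => hr1 y z h).symm
      · exact (Finset.prod_eq_zero (f := fun y => r y z) (Finset.mem_univ z) (hr0 z h)).symm
    rw [hprod]
    exact Subalgebra.prod_mem f.range fun y _ => hr y
  obtain ⟨e, he, hfe⟩ := CompleteOrthogonalIdempotents.lift_of_isNilpotent_ker
    (f : B →+* (X → F)) hker hv hrange
  exact ⟨fun q => e q, he.map (B.val : B →+* IncidenceAlgebra F X), fun q => (e q).2,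
    fun q x => congrFun (congrFun hfe q) x⟩

end IsGrading

end

/-! ### The diagonal blocks, triangular forms and averages -/

section
variable {F X G : Type*} [Field F] [PartialOrder X] [LocallyFiniteOrder X] [DecidableEq X]
  [CommGroup G] {Γ : G → Submodule F (IncidenceAlgebra F X)}

namespace IsGrading

variable [Finite X] (hΓ : IsGrading Γ) {ι : Type*} [Fintype ι] {e : ι → IncidenceAlgebra F X}
  (he : CompleteOrthogonalIdempotents e) {i : ι} {x : X}
  (h0 : ∀ y, e i y y ≠ 0 → diagSetoid Γ x y)
include hΓ he h0

/-- An element of a diagonal block with zero diagonal vanishes. -/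
theorem block_eq_zero {a : IncidenceAlgebra F X} (ha : ∀ y, diagSetoid Γ x y → a y y = 0) :
    e i * a * e i = 0 :=
  peirce_eq_zero he fun p q hpq hp hq =>
    ⟨hΓ.eq_of_le_of_diagSetoid
      ((diagSetoid Γ).trans ((diagSetoid Γ).symm (h0 p hp)) (h0 q hq)) hpq, ha p (h0 p hp)⟩

theorem block_congr {a b : IncidenceAlgebra F X} (hab : ∀ y, diagSetoid Γ x y → a y y = b y y) :
    e i * a * e i = e i * b * e i := by
  rw [← sub_eq_zero, ← sub_mul, ← mul_sub]
  exact hΓ.block_eq_zero he h0 fun y hy => by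
    rw [IncidenceAlgebra.sub_apply, hab y hy, sub_self]

variable (hei : e i ∈ Γ 1) (h1 : ∀ y, diagSetoid Γ x y → e i y y = 1)
include hei h1

/-- The block is determined by diagonals on the class, where homogeneous elements of one degree are
proportional and the normalized ones multiply like the group of degrees. Hence the corners `e i * b
h * e i` form a homogeneous basis. -/
theorem exists_diagonal_block :
    ∃ ψ : MonoidAlgebra F (hΓ.diagDegrees x) →ₙₐ[F] IncidenceAlgebra F X,
      Function.Injective ψ ∧ Set.range ψ = Set.range (fun a => e i * a * e i) ∧ ψ 1 = e i ∧
        ∀ h : hΓ.diagDegrees x, ψ (MonoidAlgebra.single h 1) ∈ Γ (h : G) := by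
  obtain ⟨b, hb, hbx⟩ := hΓ.exists_normalized x
  have hmem : ∀ h : hΓ.diagDegrees x, e i * b h * e i ∈ Γ (h : G) := fun h => by
    simpa using hΓ.mul_mem (hΓ.mul_mem hei (hb h)) hei
  let β : hΓ.diagDegrees x →ₙ* IncidenceAlgebra F X :=
    { toFun := fun h => e i * b h * e i
      map_mul' := fun h k => by
        have : e i * b h * e i * (e i * b k * e i) = e i * (b h * e i * b k) * e i := by
          rw [show e i * b h * e i * (e i * b k * e i) = e i * b h * (e i * e i) * b k * e i by
            simp only [mul_assoc], he.idem i]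
          simp only [mul_assoc]
        rw [this]
        refine hΓ.block_congr he h0 fun y hy => ?_
        rw [mul_apply_self, mul_apply_self, h1 y hy, mul_one, hΓ.normalized_mul hy hb hbx] }
  have hβ1 : e i * b 1 * e i = e i := by
    have : e i * b 1 * e i = e i * 1 * e i := hΓ.block_congr he h0 fun y hy => by
      rw [hΓ.normalized_one hy hb hbx, IncidenceAlgebra.one_apply, if_pos rfl]
    rw [this, mul_one, he.idem i]
  let ψ := MonoidAlgebra.liftMagma F β
  have hψ : ∀ h c, ψ (MonoidAlgebra.single h c) = c • (e i * b h * e i) := fun h c => by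
    simp [ψ, β, MonoidAlgebra.liftMagma_apply_apply]
  have hψ1 : ψ 1 = e i := by rw [MonoidAlgebra.one_def, hψ, one_smul, hβ1]
  refine ⟨ψ, ?_, ?_, hψ1, fun h => by rw [hψ, one_smul]; exact hmem h⟩
  · rw [injective_iff_map_eq_zero]
    intro f hf
    have hproj : ∀ h : hΓ.diagDegrees x, ∀ f : MonoidAlgebra F (hΓ.diagDegrees x),
        hΓ.proj (h : G) (ψ f) = f.coeff h • (e i * b h * e i) := by
      intro h f
      induction f using MonoidAlgebra.induction_linear with
      | zero => simp
      | add f g hf hg => rw [map_add, map_add, hf, hg, MonoidAlgebra.coeff_add,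
          Finsupp.add_apply, add_smul]
      | single k c =>
        rw [hψ, map_smul, MonoidAlgebra.coeff_single]
        by_cases hk : k = h
        · rw [hk, hΓ.proj_of_mem (hmem h), Finsupp.single_eq_same]
        · rw [hΓ.proj_of_mem_ne (fun h' => hk (Subtype.ext h')) (hmem k), smul_zero,
            Finsupp.single_eq_of_ne' hk, zero_smul]
    ext h
    have h2 := hproj h f
    rw [hf, map_zero] at h2
    refine (smul_eq_zero.mp h2.symm).resolve_right fun h3 => ?_
    have h4 := congrArg (fun a : IncidenceAlgebra F X => a x x) h3
    simp only [mul_apply_self, hbx, h1 x ((diagSetoid Γ).refl x), mul_one,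
      IncidenceAlgebra.zero_apply, one_ne_zero] at h4
  · ext a
    constructor
    · rintro ⟨f, rfl⟩
      refine ⟨ψ f, ?_⟩
      change e i * ψ f * e i = ψ f
      rw [← hψ1, ← map_mul, ← map_mul, one_mul, mul_one]
    · rintro ⟨a, rfl⟩
      change ∃ f, ψ f = e i * a * e i
      refine hΓ.homogeneous_induction a (fun g a ha => ?_) ⟨0, by simp⟩ ?_
      · by_cases hg : g ∈ hΓ.diagDegrees x
        · refine ⟨MonoidAlgebra.single ⟨g, hg⟩ (a x x), ?_⟩
          rw [hψ, ← smul_mul_assoc, ← mul_smul_comm]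
          refine hΓ.block_congr he h0 fun y hy => ?_
          rw [hΓ.apply_self_eq_mul hy hb hbx (h := ⟨g, hg⟩) ha]
          rfl
        · refine ⟨0, ?_⟩
          rw [map_zero, hΓ.block_eq_zero he h0 fun y hy => hΓ.apply_self_eq_zero hy hg ha]
      · rintro a c ⟨f, hf⟩ ⟨g, hg⟩
        exact ⟨f + g, by rw [map_add, hf, hg, mul_add, add_mul]⟩

/-- The values `b k y y` are `n`-th roots of unity in `F`. If these had too small a common order
`m`, then `b (k ^ m)` would have diagonal `1` on the class, so its corner would be `e i`, of degree
both `1` and `k ^ m ≠ 1`. -/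
theorem exists_isPrimitiveRoot :
    ∃ ζ : F, IsPrimitiveRoot ζ (Monoid.exponent (hΓ.diagDegrees x)) := by
  have := hΓ.finite_diagDegrees x
  obtain ⟨b, hb, hbx⟩ := hΓ.exists_normalized x
  set n := Monoid.exponent (hΓ.diagDegrees x)
  have : NeZero n := ⟨Monoid.exponent_ne_zero_of_finite⟩
  obtain ⟨k, hk⟩ : ∃ k : hΓ.diagDegrees x, orderOf k = n :=
    Monoid.exists_orderOf_eq_exponent Monoid.ExponentExists.of_finite
  obtain ⟨ζ, hζ⟩ := IsCyclic.exists_generator (α := rootsOfUnity n F)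
  have hζn : ζ ^ n = 1 := by
    ext
    simpa using congrArg Units.val (mem_rootsOfUnity n _ |>.mp ζ.2)
  have hpow : k ^ orderOf ζ = 1 := by
    by_contra hne
    have hdiag : ∀ y, diagSetoid Γ x y → b (k ^ orderOf ζ) y y = (1 : IncidenceAlgebra F X) y y := by
      intro y hy
      let η : hΓ.diagDegrees x →* F :=
        { toFun := fun h => b h y y
          map_one' := hΓ.normalized_one hy hb hbx
          map_mul' := hΓ.normalized_mul hy hb hbx }
      have hroot : η.toHomUnits k ∈ rootsOfUnity n F := by
        rw [mem_rootsOfUnity, ← map_pow, ← hk, pow_orderOf_eq_one, map_one]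
      have h2 : (⟨η.toHomUnits k, hroot⟩ : rootsOfUnity n F) ^ orderOf ζ = 1 := by
        obtain ⟨m, hm⟩ := hζ ⟨η.toHomUnits k, hroot⟩
        have hm' : ζ ^ m = ⟨η.toHomUnits k, hroot⟩ := hm
        rw [← hm', ← zpow_natCast, zpow_comm, zpow_natCast, pow_orderOf_eq_one, one_zpow]
      have h3 : η k ^ orderOf ζ = 1 := by
        have := congrArg (fun z : rootsOfUnity n F => ((z : Fˣ) : F)) h2
        simpa using this
      rw [← map_pow] at h3
      rw [IncidenceAlgebra.one_apply, if_pos rfl]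
      exact h3
    have h4 := hΓ.block_congr he h0 hdiag
    rw [mul_one, he.idem i] at h4
    have hmem : e i ∈ Γ ((k ^ orderOf ζ : hΓ.diagDegrees x) : G) := by
      rw [← h4]
      have := hΓ.mul_mem (hΓ.mul_mem hei (hb (k ^ orderOf ζ))) hei
      rwa [one_mul, mul_one] at this
    have h5 := hΓ.eq_zero_of_mem_of_mem (fun h => hne (Subtype.ext h)) hmem hei
    have h6 := h1 x ((diagSetoid Γ).refl x)
    rw [h5, IncidenceAlgebra.zero_apply] at h6
    exact zero_ne_one h6
  have hord : orderOf ζ = n :=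
    Nat.dvd_antisymm (orderOf_dvd_of_pow_eq_one hζn)
      (hk.symm.dvd.trans (orderOf_dvd_of_pow_eq_one hpow))
  refine ⟨((ζ : Fˣ) : F), ?_⟩
  have hprim := IsPrimitiveRoot.coe_units_iff.mpr
    (IsPrimitiveRoot.coe_submonoidClass_iff.mpr (IsPrimitiveRoot.orderOf ζ))
  rwa [hord] at hprim

end IsGrading

theorem IsGrading.exists_isBlockTriangularForm [CharZero F] [Finite X] (hΓ : IsGrading Γ) :
    ∃ (t : ℕ) (H : Fin t → Subgroup G) (e : Fin t → IncidenceAlgebra F X),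
      IsBlockTriangularForm Γ H e := by
  classical
  have := Fintype.ofFinite X
  obtain ⟨e, he, he1, hdiag⟩ := hΓ.exists_idempotents
  -- Lower sets have equal size within a class and grow strictly along `<`, so sorting by this size
  -- puts nonzero corners above the diagonal.
  let k : Quotient (diagSetoid Γ) → ℕ :=
    Quotient.lift (fun x => (Set.Iic x).ncard) fun _ _ h => hΓ.ncard_Iic_eq h
  let σ₀ := (Fintype.equivFin (Quotient (diagSetoid Γ))).symm
  let σ := (Tuple.sort (k ∘ σ₀)).trans σ₀
  have hσ : Monotone (k ∘ σ) := Tuple.monotone_sort (k ∘ σ₀)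
  let r : Fin _ → X := fun i => (σ i).out
  have hr : ∀ i y, e (σ i) y y = if diagSetoid Γ (r i) y then 1 else 0 := by
    intro i y
    rw [hdiag]
    congr 1
    rw [← (σ i).out_eq, Quotient.eq]
    exact propext ⟨(diagSetoid Γ).symm, (diagSetoid Γ).symm⟩
  have h0 : ∀ i y, e (σ i) y y ≠ 0 → diagSetoid Γ (r i) y := fun i y h => by
    by_contra hn
    rw [hr, if_neg hn] at h
    exact h rfl
  have h1 : ∀ i y, diagSetoid Γ (r i) y → e (σ i) y y = 1 := fun i y h => by
    rw [hr, if_pos h]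
  have hcoi : CompleteOrthogonalIdempotents fun i => e (σ i) :=
    (CompleteOrthogonalIdempotents.equiv σ).mpr he
  refine ⟨_, fun i => hΓ.diagDegrees (r i), fun i => e (σ i), hcoi, ?_,
    fun i => hΓ.finite_diagDegrees _, fun _ _ _ _ _ => mul_comm _ _, ?_,
    fun i => hΓ.exists_isPrimitiveRoot hcoi (h0 i) (he1 _) (h1 i),
    fun i => hΓ.exists_diagonal_block hcoi (h0 i) (he1 _) (h1 i)⟩
  · intro i j hji a
    refine peirce_eq_zero (e := fun i => e (σ i)) hcoi fun p q hpq hp hq => ?_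
    have hkp : ∀ l z, e (σ l) z z ≠ 0 → k (σ l) = (Set.Iic z).ncard ∧ Quotient.mk _ z = σ l := by
      intro l z hz
      have : Quotient.mk _ z = σ l := by
        by_contra hn
        rw [hdiag, if_neg hn] at hz
        exact hz rfl
      exact ⟨by rw [← this]; rfl, this⟩
    obtain ⟨hp1, hp2⟩ := hkp i p hp
    obtain ⟨hq1, hq2⟩ := hkp j q hq
    have hne : p ≠ q := by
      rintro rfl
      exact hji.ne (σ.injective (hq2.symm.trans hp2))
    have h2 := ncard_Iic_lt (lt_of_le_of_ne hpq hne)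
    have h3 : k (σ j) ≤ k (σ i) := hσ hji.le
    omega
  · intro i
    have := hΓ.finite_diagDegrees (r i)
    rw [CharP.ringChar_zero_iff_CharZero F |>.mpr inferInstance, zero_dvd_iff]
    exact Nat.card_pos.ne'

/-- The diagonal supports of the units of a block triangular form are the classes. -/
theorem IsBlockTriangularForm.diagSetoid_of_mem (hΓ : IsGrading Γ) {t : ℕ}
    {H : Fin t → Subgroup G} {e : Fin t → IncidenceAlgebra F X}
    (hH : IsBlockTriangularForm Γ H e) {i : Fin t} :
    e i ∈ Γ 1 ∧ ∀ x y, x ∈ diagSupport (e i) → y ∈ diagSupport (e i) → diagSetoid Γ x y := by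
  obtain ⟨ψ, -, hrange, hone, hmem⟩ := hH.diagonal_block i
  have hei : e i ∈ Γ 1 := by
    rw [← hone, MonoidAlgebra.one_def]
    exact hmem 1
  have hidem : ∀ x, x ∈ diagSupport (e i) → e i x x = 1 := fun x hx => by
    have := mul_apply_self (e i) (e i) x
    rw [hH.idempotents.idem i] at this
    exact (mul_eq_left₀ hx).mp this.symm
  -- The degree `1` part of the group algebra is spanned by its unit, so degree `1` elements have
  -- constant diagonal on the support of `e i`.
  have hproj : ∀ f : MonoidAlgebra F (H i), ∃ c : F, hΓ.proj 1 (ψ f) = c • e i := by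
    intro f
    induction f using MonoidAlgebra.induction_linear with
    | zero => exact ⟨0, by simp⟩
    | add f g hf hg =>
      obtain ⟨c, hc⟩ := hf
      obtain ⟨d, hd⟩ := hg
      exact ⟨c + d, by rw [map_add, map_add, hc, hd, add_smul]⟩
    | single k c =>
      have hs : MonoidAlgebra.single k c = c • MonoidAlgebra.single k (1 : F) := by simp
      rw [hs, map_smul, map_smul]
      by_cases hk : k = 1
      · subst hk
        exact ⟨c, by rw [← MonoidAlgebra.one_def, hone, hΓ.proj_of_mem hei]⟩
      · refine ⟨0, ?_⟩
        rw [hΓ.proj_of_mem_ne (g := 1) (fun h => hk (Subtype.ext h)) (hmem k), smul_zero, zero_smul]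
  refine ⟨hei, fun x y hx hy a ha => ?_⟩
  have h1 : e i * a * e i ∈ Γ 1 := by simpa using hΓ.mul_mem (hΓ.mul_mem hei ha) hei
  obtain ⟨f, hf⟩ : e i * a * e i ∈ Set.range ψ := hrange ▸ ⟨a, rfl⟩
  obtain ⟨c, hc⟩ := hproj f
  rw [hf, hΓ.proj_of_mem h1] at hc
  have h2 : ∀ z, z ∈ diagSupport (e i) → a z z = c := fun z hz => by
    have := congrArg (fun b : IncidenceAlgebra F X => b z z) hc
    simpa only [mul_apply_self, IncidenceAlgebra.constSMul_apply, hidem z hz, one_mul, mul_one,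
      smul_eq_mul] using this
  rw [h2 x hx, h2 y hy]

/-- Conjugation brings complete orthogonal idempotents to diagonal form. -/
theorem exists_algEquiv_isDiagonal [Finite X] {ι : Type*} [Fintype ι]
    {e : ι → IncidenceAlgebra F X} (he : CompleteOrthogonalIdempotents e) :
    ∃ φ : IncidenceAlgebra F X ≃ₐ[F] IncidenceAlgebra F X, ∀ i, IsDiagonal (φ (e i)) := by
  obtain ⟨u, hu⟩ := exists_conj_eq_diagMatrix he
  refine ⟨MulSemiringAction.toAlgEquiv F _ (ConjAct.toConjAct u), fun i => ?_⟩
  have : MulSemiringAction.toAlgEquiv F (IncidenceAlgebra F X) (ConjAct.toConjAct u) (e i) =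
      ↑u * e i * ↑u⁻¹ := by
    simp [ConjAct.units_smul_def]
  rw [this, hu]
  exact isDiagonal_diagMatrix _

/-- The set `𝒜` is the group of all class-preserving automorphisms, independent of `i`. It is
transitive on the support of `e i`, so `lam` is the order of a point stabilizer. -/
theorem IsBlockTriangularForm.exists_finset_orderIso [Finite X] (hΓ : IsGrading Γ) {t : ℕ}
    {H : Fin t → Subgroup G} {e : Fin t → IncidenceAlgebra F X}
    (hH : IsBlockTriangularForm Γ H e) (hdiag : ∀ i, IsDiagonal (e i)) :
    ∃ 𝒜 : Finset (X ≃o X), ∀ i, ∃ lam : ℕ, 0 < lam ∧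
      ∀ x ∈ diagSupport (e i), ∑ α ∈ 𝒜, induced F α (diagUnit F x) = lam • e i := by
  classical
  have : Finite (X ≃o X) := Finite.of_injective (fun α => (α : X → X)) DFunLike.coe_injective
  have := Fintype.ofFinite (X ≃o X)
  let 𝒜 : Finset (X ≃o X) := Finset.univ.filter fun α => ∀ z, diagSetoid Γ (α z) z
  have h𝒜 : ∀ α, α ∈ 𝒜 ↔ ∀ z, diagSetoid Γ (α z) z := fun α => by simp [𝒜]
  have hmul : ∀ α ∈ 𝒜, ∀ β ∈ 𝒜, α * β ∈ 𝒜 := fun α hα β hβ => (h𝒜 _).mpr fun z =>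
    (diagSetoid Γ).trans ((h𝒜 α).mp hα (β z)) ((h𝒜 β).mp hβ z)
  have hinv : ∀ α ∈ 𝒜, α⁻¹ ∈ 𝒜 := fun α hα => (h𝒜 _).mpr fun z => by
    have := (h𝒜 α).mp hα (α⁻¹ z)
    rw [RelIso.apply_inv_self] at this
    exact (diagSetoid Γ).symm this
  let N : X → X → ℕ := fun x y => (𝒜.filter fun α => α x = y).card
  -- Translating by group elements on both sides shows that the number of `α` with `α x = y` depends
  -- only on the orbits.
  have hN : ∀ x y, ∀ β ∈ 𝒜, ∀ γ ∈ 𝒜, N (β x) (γ y) = N x y := by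
    intro x y β hβ γ hγ
    refine Finset.card_bij' (fun α _ => γ⁻¹ * α * β) (fun α _ => γ * α * β⁻¹) ?_ ?_ ?_ ?_
    · intro α hα
      rw [Finset.mem_filter] at hα ⊢
      refine ⟨hmul _ (hmul _ (hinv _ hγ) _ hα.1) _ hβ, ?_⟩
      simp [RelIso.mul_apply, hα.2]
    · intro α hα
      rw [Finset.mem_filter] at hα ⊢
      refine ⟨hmul _ (hmul _ hγ _ hα.1) _ (hinv _ hβ), ?_⟩
      simp [RelIso.mul_apply, hα.2]
    · intro α _
      simp [mul_assoc]
    · intro α _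
      simp [mul_assoc]
  refine ⟨𝒜, fun i => ?_⟩
  obtain ⟨hei, hclass⟩ := hH.diagSetoid_of_mem hΓ (i := i)
  by_cases hne : ∃ x₀, x₀ ∈ diagSupport (e i)
  swap
  · exact ⟨1, one_pos, fun x hx => absurd ⟨x, hx⟩ hne⟩
  obtain ⟨x₀, hx₀⟩ := hne
  have hone : (1 : X ≃o X) ∈ 𝒜 := (h𝒜 _).mpr fun z => (diagSetoid Γ).refl z
  refine ⟨N x₀ x₀, Finset.card_pos.mpr ⟨1, Finset.mem_filter.mpr ⟨hone, rfl⟩⟩, fun x hx => ?_⟩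
  have htrans : ∀ y, y ∈ diagSupport (e i) → ∃ α ∈ 𝒜, α x₀ = y := fun y hy => by
    obtain ⟨α, hα, hαy⟩ := hΓ.exists_orderIso_apply_eq (hclass x₀ y hx₀ hy)
    exact ⟨α, (h𝒜 α).mpr hα, hαy⟩
  ext p q _
  have hsmul : (N x₀ x₀ • e i) p q = N x₀ x₀ • e i p q := rfl
  rw [hsmul, sum_apply]
  simp only [induced_diagUnit]
  by_cases hpq : p = q
  · subst hpq
    have hsum : ∑ α ∈ 𝒜, (diagUnit F (α x)) p p = (N x p : F) := by
      simp [diagUnit, N, Finset.sum_boole, eq_comm]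
    rw [hsum]
    by_cases hp : p ∈ diagSupport (e i)
    · obtain ⟨β, hβ, rfl⟩ := htrans x hx
      obtain ⟨γ, hγ, rfl⟩ := htrans p hp
      have h1 : e i (γ x₀) (γ x₀) = 1 := by
        have := mul_apply_self (e i) (e i) (γ x₀)
        rw [hH.idempotents.idem i] at this
        exact (mul_eq_left₀ hp).mp this.symm
      rw [hN _ _ β hβ γ hγ, h1, nsmul_one]
    · have hp0 : e i p p = 0 := not_not.mp hp
      have : N x p = 0 := by
        rw [Finset.card_eq_zero, Finset.filter_eq_empty_iff]
        rintro α hα rfl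
        -- As `e i` has degree `1`, its diagonal is constant on classes, so `𝒜` cannot leave its
        -- support.
        exact hx (((h𝒜 α).mp hα x _ hei).symm.trans hp0)
      rw [this, hp0, Nat.cast_zero, smul_zero]
  · rw [hdiag i p q hpq, smul_zero]
    refine Finset.sum_eq_zero fun α _ => if_neg fun h => hpq (h.1.trans h.2.symm)

end
end IncidenceGrading

open IncidenceGrading in
theorem mainTheorem5 {F X G : Type*} [Field F] [CharZero F]
    [PartialOrder X] [Finite X] [LocallyFiniteOrder X] [DecidableEq X] [CommGroup G]
    (Γ : G → Submodule F (IncidenceAlgebra F X)) (hΓ : IsGrading Γ) :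
    -- the graded algebra has a block triangular form
    (∃ (t : ℕ) (H : Fin t → Subgroup G) (e : Fin t → IncidenceAlgebra F X),
      IsBlockTriangularForm Γ H e) ∧
    -- up to a graded isomorphism, the units of the diagonal blocks are diagonal
    (∀ (t : ℕ) (H : Fin t → Subgroup G) (e : Fin t → IncidenceAlgebra F X),
      IsBlockTriangularForm Γ H e →
        ∃ φ : IncidenceAlgebra F X ≃ₐ[F] IncidenceAlgebra F X,
          IsGrading (mapGrading φ Γ) ∧
          IsBlockTriangularForm (mapGrading φ Γ) H (fun i => φ (e i)) ∧
          ∀ i, IsDiagonal (φ (e i))) ∧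
    -- whenever they are diagonal, they are averages over a set of poset automorphisms
    (∀ (φ : IncidenceAlgebra F X ≃ₐ[F] IncidenceAlgebra F X)
      (t : ℕ) (H : Fin t → Subgroup G) (e : Fin t → IncidenceAlgebra F X),
      IsBlockTriangularForm (mapGrading φ Γ) H e → (∀ i, IsDiagonal (e i)) →
        ∃ 𝒜 : Finset (X ≃o X), ∀ i, ∃ lam : ℕ, 0 < lam ∧
          ∀ x ∈ diagSupport (e i),
            ∑ α ∈ 𝒜, induced F α (diagUnit F x) = lam • e i) := by
  refine ⟨hΓ.exists_isBlockTriangularForm, fun t H e hH => ?_, fun φ t H e hH hdiag =>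
    hH.exists_finset_orderIso (hΓ.map φ) hdiag⟩
  obtain ⟨φ, hφ⟩ := exists_algEquiv_isDiagonal hH.idempotents
  exact ⟨φ, hΓ.map φ, hH.map φ, hφ⟩
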